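/- For integers $n,t\ge 0$, let $K(n,t)$ be the Kneser graph: its vertices are the $t$-element subsets of $\{1,\dots,n\}$, and two distinct vertices are adjacent if and only if they are disjoint. Let $X$ be its clique complex, whose faces are the cliques of $K(n,t)$, and let $X_i$ be the set of faces with $i+1$ elements. Fix any total order on the vertex set of $K(n,t)$. For $F=\{x_0<x_1<\dots<x_m\}$ and a set $K$ of vertices, put $[F:K]=(-1)^j$ if $K\subset F$ and $F\setminus K=\{x_j\}$, and $[F:K]=0$ otherwise. Let $\delta_i:\mathbb R^{X_i}\to\mathbb R^{X_{i+1}}$ be the coboundary map, i.e. the linear map whose matrix has the entry $[H:F]$ in row $H\in X_{i+1}$ and column $F\in X_i$. Suppose that $n\ge 5t$. Then: 1. if $t\ge 1$, any four (not necessarily distinct) vertices of $K(n,t)$ have a common neighbour; 2. $\operatorname{im}\delta_0=\ker\delta_1$. -/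

import Mathlib

/-- The clique complex of a graph: its faces are the nonempty finite cliques. -/
def cliqueComplex {V : Type*} (G : SimpleGraph V) : AbstractSimplicialComplex V where
  faces := {F : Finset V | F.Nonempty ∧ G.IsClique (F : Set V)}
  isRelLowerSet_faces := fun _ hF =>
    ⟨hF.1, fun _ hK hne => ⟨hne, hF.2.subset (Finset.coe_subset.2 hK)⟩⟩
  singleton_mem := fun v => ⟨Finset.singleton_nonempty v, by simp⟩

/-- The set `X_i` of `i`-dimensional faces of `X`, i.e. the faces with `i + 1` elements. -/
def FaceOfDim {V : Type*} (X : AbstractSimplicialComplex V) (i : ℕ) : Type _ :=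
  {F : Finset V // F ∈ X.faces ∧ F.card = i + 1}

noncomputable instance FaceOfDim.instFintype {V : Type*} [Finite V]
    (X : AbstractSimplicialComplex V) (i : ℕ) : Fintype (FaceOfDim X i) :=
  haveI : Finite (FaceOfDim X i) :=
    inferInstanceAs (Finite {F : Finset V // F ∈ X.faces ∧ F.card = i + 1})
  Fintype.ofFinite _

/-- The signed incidence number `[F : K]`, with respect to the ordering of the vertices:
if `F = {x_0 < x_1 < ⋯ < x_i}`, `K ⊆ F` and `F \ K = {x_j}`, it is `(-1) ^ j`
(note that `j` is the number of elements of `F` below `x_j`); otherwise it is `0`. -/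
def incidenceSign {V : Type*} [LinearOrder V] (F K : Finset V) : ℝ :=
  if K ⊆ F ∧ (F \ K).card = 1 then
    ∑ x ∈ F \ K, (-1 : ℝ) ^ (F.filter (fun y => y < x)).card
  else 0

/-- The matrix of the coboundary map `δ_i`: rows are indexed by `X_{i+1}`, columns by `X_i`. -/
def coboundaryMatrix {V : Type*} [LinearOrder V] (X : AbstractSimplicialComplex V) (i : ℕ) :
    Matrix (FaceOfDim X (i + 1)) (FaceOfDim X i) ℝ :=
  Matrix.of fun H F => incidenceSign H.1 F.1

/-- The coboundary map `δ_i : ℝ^{X_i} → ℝ^{X_{i+1}}`. -/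
noncomputable def coboundary {V : Type*} [LinearOrder V] [Finite V]
    (X : AbstractSimplicialComplex V) (i : ℕ) :
    (FaceOfDim X i → ℝ) →ₗ[ℝ] (FaceOfDim X (i + 1) → ℝ) :=
  (coboundaryMatrix X i).mulVecLin

/-- The vertices of the Kneser graph `K(n, t)`: the `t`-subsets of an `n`-element set. -/
def KneserVertex (n t : ℕ) : Type :=
  {A : Finset (Fin n) // A.card = t}

instance KneserVertex.instFinite (n t : ℕ) : Finite (KneserVertex n t) :=
  inferInstanceAs (Finite {A : Finset (Fin n) // A.card = t})

/-- The Kneser graph `K(n, t)`: two (distinct) `t`-subsets are adjacent iff they are disjoint.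
Distinctness follows from disjointness unless `t = 0`. -/
def kneserGraph (n t : ℕ) : SimpleGraph (KneserVertex n t) where
  Adj A B := A ≠ B ∧ Disjoint A.1 B.1
  symm := ⟨fun _ _ h => ⟨h.1.symm, h.2.symm⟩⟩
  loopless := ⟨fun _ h => h.1 rfl⟩

/-! A 1-cocycle is an antisymmetric function on oriented edges that is additive on triangles
(`orientedValue_add`). Fix a vertex `x` and integrate the cocycle along a path of length two from
`x` to `v`. Two such paths form a closed walk of length four; a common neighbour of its vertices
cones it off into triangles, so the integral depends only on `v` and is a potential for the cocycle.
In the Kneser graph, four `t`-sets cover at most `4t` of the `n ≥ 5t` points, which leaves room for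
a common neighbour. -/

/-- The extension by zero of a cochain to all finite sets of vertices. -/
noncomputable def extendCochain {V : Type*} (X : AbstractSimplicialComplex V) (i : ℕ)
    (f : FaceOfDim X i → ℝ) (F : Finset V) : ℝ :=
  open Classical in if h : F ∈ X.faces ∧ F.card = i + 1 then f ⟨F, h⟩ else 0

theorem extendCochain_of_mem {V : Type*} (X : AbstractSimplicialComplex V) (i : ℕ)
    (f : FaceOfDim X i → ℝ) (F : FaceOfDim X i) : extendCochain X i f F.1 = f F :=
  dif_pos F.2

theorem incidenceSign_erase {V : Type*} [LinearOrder V] {H : Finset V} {x : V} (hx : x ∈ H) :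
    incidenceSign H (H.erase x) = (-1 : ℝ) ^ (H.filter (fun y => y < x)).card := by
  have h : H \ H.erase x = {x} := by
    ext y; simp only [Finset.mem_sdiff, Finset.mem_erase, Finset.mem_singleton]
    constructor
    · rintro ⟨h1, h2⟩; by_contra h; exact h2 ⟨h, h1⟩
    · rintro rfl; exact ⟨hx, fun h => h.1 rfl⟩
  rw [incidenceSign, h, if_pos ⟨Finset.erase_subset _ _, Finset.card_singleton _⟩,
    Finset.sum_singleton]

/-- In row `H` only the facets `H.erase x` have a nonzero entry. Extension by zero spares proofs
that these are faces. -/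
theorem coboundary_apply {V : Type*} [LinearOrder V] [Finite V]
    (X : AbstractSimplicialComplex V) (i : ℕ) (f : FaceOfDim X i → ℝ)
    (H : FaceOfDim X (i + 1)) :
    coboundary X i f H = ∑ x ∈ H.1,
      (-1 : ℝ) ^ (H.1.filter (fun y => y < x)).card * extendCochain X i f (H.1.erase x) := by
  have hcard (x : H.1) : (H.1.erase x).card = i + 1 := by
    rw [Finset.card_erase_of_mem x.2, H.2.2]; rfl
  let e (x : H.1) : FaceOfDim X i := ⟨H.1.erase x, (X.isRelLowerSet_faces H.2.1).2 (Finset.erase_subset _ _)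
      (Finset.card_pos.1 (by rw [hcard]; omega)), hcard x⟩
  rw [← Finset.sum_coe_sort H.1]
  symm
  change _ = ∑ F, incidenceSign H.1 F.1 * f F
  refine Finset.sum_of_injOn e ?_ (fun _ _ => Finset.mem_coe.2 (Finset.mem_univ _)) ?_ ?_
  · intro x _ y _ hxy
    exact Subtype.ext (Finset.erase_injOn H.1 x.2 y.2 (congrArg Subtype.val hxy))
  · intro F _ hF
    rw [incidenceSign, if_neg, zero_mul]
    rintro ⟨hsub, h1⟩
    obtain ⟨x, hx⟩ := Finset.card_eq_one.1 h1
    have hxH : x ∈ H.1 := (Finset.mem_sdiff.1 (hx ▸ Finset.mem_singleton_self x)).1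
    refine hF ⟨⟨x, hxH⟩, by simp, Subtype.ext ?_⟩
    change H.1.erase x = F.1
    rw [Finset.erase_eq, ← hx, Finset.sdiff_sdiff_eq_self hsub]
  · intro x _
    rw [← incidenceSign_erase x.2, ← extendCochain_of_mem X i f (e x)]

theorem sum_sign_erase_pair {V : Type*} [LinearOrder V] (φ : Finset V → ℝ) {a b : V}
    (hab : a < b) :
    ∑ x ∈ ({a, b} : Finset V),
      (-1 : ℝ) ^ (({a, b} : Finset V).filter (fun y => y < x)).card *
        φ (({a, b} : Finset V).erase x) = φ {b} - φ {a} := by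
  have ha : ({a, b} : Finset V).erase a = {b} := by
    ext y; simp only [Finset.mem_erase, Finset.mem_insert, Finset.mem_singleton]; grind
  have hb : ({a, b} : Finset V).erase b = {a} := by
    ext y; simp only [Finset.mem_erase, Finset.mem_insert, Finset.mem_singleton]; grind
  rw [Finset.sum_pair hab.ne, ha, hb]
  simp [Finset.filter_insert, Finset.filter_singleton, hab, hab.not_gt]
  ring

theorem sum_sign_erase_triple {V : Type*} [LinearOrder V] (φ : Finset V → ℝ) {a b c : V}
    (hab : a < b) (hbc : b < c) :
    ∑ x ∈ ({a, b, c} : Finset V),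
      (-1 : ℝ) ^ (({a, b, c} : Finset V).filter (fun y => y < x)).card *
        φ (({a, b, c} : Finset V).erase x) = φ {b, c} - φ {a, c} + φ {a, b} := by
  have hac := hab.trans hbc
  have ha : ({a, b, c} : Finset V).erase a = {b, c} := by
    ext y; simp only [Finset.mem_erase, Finset.mem_insert, Finset.mem_singleton]; grind
  have hb : ({a, b, c} : Finset V).erase b = {a, c} := by
    ext y; simp only [Finset.mem_erase, Finset.mem_insert, Finset.mem_singleton]; grind
  have hc : ({a, b, c} : Finset V).erase c = {a, b} := by
    ext y; simp only [Finset.mem_erase, Finset.mem_insert, Finset.mem_singleton]; grind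
  rw [Finset.sum_insert (by simp [hab.ne, hac.ne]), Finset.sum_pair hbc.ne, ha, hb, hc]
  simp [Finset.filter_insert, Finset.filter_singleton, hab, hab.not_gt, hbc, hbc.not_gt, hac,
    hac.not_gt, hab.ne]
  ring

theorem exists_lt_of_card_eq_two {V : Type*} [LinearOrder V] {F : Finset V} (h : F.card = 2) :
    ∃ a b, a < b ∧ F = {a, b} := by
  obtain ⟨a, b, hab, rfl⟩ := Finset.card_eq_two.1 h
  rcases lt_or_gt_of_ne hab with h | h
  · exact ⟨a, b, h, rfl⟩
  · exact ⟨b, a, h, Finset.pair_comm _ _⟩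

theorem exists_lt_lt_of_card_eq_three {V : Type*} [LinearOrder V] {F : Finset V}
    (h : F.card = 3) : ∃ a b c, a < b ∧ b < c ∧ F = {a, b, c} := by
  refine ⟨F.orderEmbOfFin h 0, F.orderEmbOfFin h 1, F.orderEmbOfFin h 2, by simp, by simp, ?_⟩
  ext y
  have hy : y ∈ F ↔ ∃ i, F.orderEmbOfFin h i = y := by
    rw [← Set.mem_range, Finset.range_orderEmbOfFin, Finset.mem_coe]
  rw [hy, Fin.exists_fin_succ, Fin.exists_fin_two]
  simp only [Finset.mem_insert, Finset.mem_singleton, eq_comm (a := y)]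
  rfl

/-- The value of a cochain on an oriented edge. -/
noncomputable def orientedValue {V : Type*} [LinearOrder V] (φ : Finset V → ℝ) (a b : V) : ℝ :=
  if a < b then φ {a, b} else -φ {a, b}

theorem orientedValue_swap {V : Type*} [LinearOrder V] (φ : Finset V → ℝ) {a b : V}
    (h : a ≠ b) : orientedValue φ b a = -orientedValue φ a b := by
  unfold orientedValue
  rw [Finset.pair_comm b a]
  rcases lt_or_gt_of_ne h with h | h <;> simp [h, h.not_gt]

theorem isClique_triple {V : Type*} {G : SimpleGraph V} {a b c : V} (hab : G.Adj a b)
    (hbc : G.Adj b c) (hac : G.Adj a c) : G.IsClique ({a, b, c} : Set V) := by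
  simp only [SimpleGraph.isClique_insert, SimpleGraph.isClique_singleton, Set.mem_insert_iff,
    Set.mem_singleton_iff]
  grind

/-- A cocycle is additive along the sides of a triangle. -/
theorem orientedValue_add {V : Type*} [LinearOrder V] [Finite V] {G : SimpleGraph V}
    {f : FaceOfDim (cliqueComplex G) 1 → ℝ} (hf : coboundary (cliqueComplex G) 1 f = 0)
    {a b c : V} (hab : G.Adj a b) (hbc : G.Adj b c) (hac : G.Adj a c) :
    orientedValue (extendCochain _ 1 f) a b + orientedValue (extendCochain _ 1 f) b c =
      orientedValue (extendCochain _ 1 f) a c := by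
  have key {a b c : V} (hab : G.Adj a b) (hbc : G.Adj b c) (hac : G.Adj a c)
      (h1 : a < b) (h2 : b < c) :
      orientedValue (extendCochain _ 1 f) a b + orientedValue (extendCochain _ 1 f) b c =
        orientedValue (extendCochain _ 1 f) a c := by
    have hmem : ({a, b, c} : Finset V) ∈ (cliqueComplex G).faces ∧
        ({a, b, c} : Finset V).card = 2 + 1 := by
      refine ⟨⟨by simp, ?_⟩, Finset.card_eq_three.2 ⟨a, b, c, hab.ne, hac.ne, hbc.ne, rfl⟩⟩
      simpa using isClique_triple hab hbc hac
    have h := coboundary_apply _ 1 f ⟨_, hmem⟩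
    rw [hf, sum_sign_erase_triple _ h1 h2] at h
    simp only [orientedValue, if_pos h1, if_pos h2, if_pos (h1.trans h2)]
    change (0 : ℝ) = _ at h
    linarith
  have sab := orientedValue_swap (extendCochain _ 1 f) hab.ne
  have sbc := orientedValue_swap (extendCochain _ 1 f) hbc.ne
  have sac := orientedValue_swap (extendCochain _ 1 f) hac.ne
  -- Two of the eight sign patterns are cyclic, hence impossible; the others reduce to the sorted
  -- triple by antisymmetry.
  rcases lt_or_gt_of_ne hab.ne with h1 | h1 <;> rcases lt_or_gt_of_ne hbc.ne with h2 | h2 <;>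
    rcases lt_or_gt_of_ne hac.ne with h3 | h3
  · exact key hab hbc hac h1 h2
  · exact absurd (h1.trans h2) h3.not_gt
  · linarith [key hac hbc.symm hab h3 h2]
  · linarith [key hac.symm hab hbc.symm h3 h1]
  · linarith [key hab.symm hac hbc h1 h3]
  · linarith [key hbc hac.symm hab.symm h2 h3]
  · exact absurd (h2.trans h1) h3.not_gt
  · linarith [key hbc.symm hab.symm hac.symm h2 h1]

theorem extendCochain_singleton {V : Type*} (G : SimpleGraph V)
    (g : V → ℝ) (φ : FaceOfDim (cliqueComplex G) 0 → ℝ)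
    (hφ : ∀ F v, F.1 = {v} → φ F = g v) (v : V) :
    extendCochain (cliqueComplex G) 0 φ {v} = g v := by
  let F : FaceOfDim (cliqueComplex G) 0 := ⟨{v}, (cliqueComplex G).singleton_mem v, by simp⟩
  exact (extendCochain_of_mem _ 0 φ F).trans (hφ F v rfl)

theorem coboundary_comp_coboundary_zero {V : Type*} [LinearOrder V] [Finite V]
    (G : SimpleGraph V) (φ : FaceOfDim (cliqueComplex G) 0 → ℝ) :
    coboundary (cliqueComplex G) 1 (coboundary (cliqueComplex G) 0 φ) = 0 := by
  funext H
  obtain ⟨a, b, c, hab, hbc, hH⟩ := exists_lt_lt_of_card_eq_three H.2.2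
  have edge {x y : V} (hxy : x < y) (hsub : ({x, y} : Finset V) ⊆ H.1) :
      extendCochain _ 1 (coboundary (cliqueComplex G) 0 φ) {x, y} =
        extendCochain _ 0 φ {y} - extendCochain _ 0 φ {x} := by
    let F : FaceOfDim (cliqueComplex G) 1 :=
      ⟨{x, y}, ((cliqueComplex G).isRelLowerSet_faces H.2.1).2 hsub (by simp), Finset.card_pair hxy.ne⟩
    rw [← sum_sign_erase_pair _ hxy]
    exact (extendCochain_of_mem _ 1 _ F).trans (coboundary_apply _ 0 φ F)
  rw [coboundary_apply, hH, sum_sign_erase_triple _ hab hbc,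
    edge hab (by rw [hH]; grind), edge hbc (by rw [hH]; grind),
    edge (hab.trans hbc) (by rw [hH]; grind)]
  simp

/-- If any four vertices have a common neighbour, the first cohomology of the clique complex
vanishes. -/
theorem range_coboundary_eq_ker_of_common_neighbors {V : Type*} [LinearOrder V] [Finite V]
    [Nonempty V] (G : SimpleGraph V)
    (hG : ∀ a b c d, ∃ e, G.Adj e a ∧ G.Adj e b ∧ G.Adj e c ∧ G.Adj e d) :
    LinearMap.range (coboundary (cliqueComplex G) 0) =
      LinearMap.ker (coboundary (cliqueComplex G) 1) := by
  refine le_antisymm ?_ fun f hf => ?_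
  · rintro _ ⟨φ, rfl⟩
    exact coboundary_comp_coboundary_zero G φ
  rw [LinearMap.mem_ker] at hf
  obtain ⟨x⟩ := ‹Nonempty V›
  set o := orientedValue (extendCochain _ 1 f)
  have indep {v w u : V} (hwx : G.Adj w x) (hwv : G.Adj w v) (hux : G.Adj u x)
      (huv : G.Adj u v) : o x w + o w v = o x u + o u v := by
    -- `e` is the apex of the cone over the closed walk `x, w, v, u`.
    obtain ⟨e, hex, hev, hew, heu⟩ := hG x v w u
    have h1 : o x w + o w e = o x e := orientedValue_add hf hwx.symm hew.symm hex.symm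
    have h2 : o w e + o e v = o w v := orientedValue_add hf hew.symm hev hwv
    have h3 : o x u + o u e = o x e := orientedValue_add hf hux.symm heu.symm hex.symm
    have h4 : o u e + o e v = o u v := orientedValue_add hf heu.symm hev huv
    linarith
  choose w hwx hwv using fun v => (show ∃ w, G.Adj w x ∧ G.Adj w v from
    let ⟨e, h1, h2, _⟩ := hG x v v v; ⟨e, h1, h2⟩)
  let g (v : V) : ℝ := o x (w v) + o (w v) v
  have hg {a b : V} (hab : G.Adj a b) : g b - g a = o a b := by
    -- By `indep`, one midpoint `u` serves both endpoints, so only the triangle `u, a, b` remains.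
    obtain ⟨u, hux, hua, hub, -⟩ := hG x a b b
    have h1 : g a = o x u + o u a := indep (hwx a) (hwv a) hux hua
    have h2 : g b = o x u + o u b := indep (hwx b) (hwv b) hux hub
    have h3 : o u a + o a b = o u b := orientedValue_add hf hua hab hub
    linarith
  let φ : FaceOfDim (cliqueComplex G) 0 → ℝ := fun F => ∑ v ∈ F.1, g v
  have hφ (v : V) : extendCochain _ 0 φ {v} = g v :=
    extendCochain_singleton G g φ (fun F v h => by simp [φ, h]) v
  refine ⟨φ, funext fun H => ?_⟩
  obtain ⟨a, b, hab, hH⟩ := exists_lt_of_card_eq_two H.2.2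
  have hadj : G.Adj a b := H.2.1.2 (by simp [hH]) (by simp [hH]) hab.ne
  rw [coboundary_apply, hH, sum_sign_erase_pair _ hab, hφ, hφ, hg hadj,
    ← extendCochain_of_mem _ 1 f H, hH]
  exact if_pos hab

theorem kneserGraph_exists_common_neighbor {n t : ℕ} (hnt : 5 * t ≤ n) (ht : 1 ≤ t)
    (A B C D : KneserVertex n t) : ∃ E : KneserVertex n t,
      (kneserGraph n t).Adj E A ∧ (kneserGraph n t).Adj E B ∧
      (kneserGraph n t).Adj E C ∧ (kneserGraph n t).Adj E D := by
  have hcard : t ≤ ((A.1 ∪ B.1 ∪ C.1 ∪ D.1)ᶜ).card := by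
    have h1 := Finset.card_union_le A.1 B.1
    have h2 := Finset.card_union_le (A.1 ∪ B.1) C.1
    have h3 := Finset.card_union_le (A.1 ∪ B.1 ∪ C.1) D.1
    have hA := A.2
    have hB := B.2
    have hC := C.2
    have hD := D.2
    rw [Finset.card_compl, Fintype.card_fin]
    omega
  obtain ⟨E, hE, hEt⟩ := Finset.exists_subset_card_eq hcard
  have adj (F : KneserVertex n t) (hF : F.1 ⊆ A.1 ∪ B.1 ∪ C.1 ∪ D.1) :
      (kneserGraph n t).Adj ⟨E, hEt⟩ F := by
    have hd : Disjoint E F.1 :=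
      Finset.disjoint_left.2 fun x hx hxF => Finset.mem_compl.1 (hE hx) (hF hxF)
    refine ⟨?_, hd⟩
    rintro rfl
    -- A set disjoint from itself is empty, which `1 ≤ t` excludes.
    have h0 : E = ∅ := disjoint_self.1 hd
    rw [h0, Finset.card_empty] at hEt
    omega
  exact ⟨⟨E, hEt⟩, adj A (by grind), adj B (by grind), adj C (by grind), adj D (by grind)⟩

instance KneserVertex.instSubsingletonZero (n : ℕ) : Subsingleton (KneserVertex n 0) :=
  ⟨fun A B => Subtype.ext ((Finset.card_eq_zero.1 A.2).trans (Finset.card_eq_zero.1 B.2).symm)⟩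

theorem mainTheorem11 (n t : ℕ) (hnt : 5 * t ≤ n) :
    (1 ≤ t → ∀ A B C D : KneserVertex n t, ∃ E : KneserVertex n t,
      (kneserGraph n t).Adj E A ∧ (kneserGraph n t).Adj E B ∧
      (kneserGraph n t).Adj E C ∧ (kneserGraph n t).Adj E D) ∧
    ∀ _ : LinearOrder (KneserVertex n t),
      LinearMap.range (coboundary (cliqueComplex (kneserGraph n t)) 0) =
        LinearMap.ker (coboundary (cliqueComplex (kneserGraph n t)) 1) := by
  refine ⟨kneserGraph_exists_common_neighbor hnt, fun _ => ?_⟩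
  rcases Nat.eq_zero_or_pos t with rfl | ht
  -- For `t = 0` the only vertex is the empty set, so there are no edges: both sides are subspaces
  -- of a zero space.
  · have : IsEmpty (FaceOfDim (cliqueComplex (kneserGraph n 0)) 1) :=
      ⟨fun F => absurd F.2.2 (by have := Finset.card_le_one_of_subsingleton F.1; omega)⟩
    exact Subsingleton.elim _ _
  · have : Nonempty (KneserVertex n t) := by
      obtain ⟨A, -, hA⟩ := Finset.exists_subset_card_eq (s := (Finset.univ : Finset (Fin n)))
        (n := t) (by rw [Finset.card_univ, Fintype.card_fin]; omega)
      exact ⟨⟨A, hA⟩⟩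
    exact range_coboundary_eq_ker_of_common_neighbors _
      (kneserGraph_exists_common_neighbor hnt ht)
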